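/- Let $g\in\mathbb N$. Let $\mathbb C^{3g}$ have coordinates $b_{i,j}$, $i\in\{1,2,3\}$, $j\in\{1,3,\dots,2g-1\}$; let $\mathbb C^{g(g-1)/2}$ have coordinates $p_{k,l}$, $k\le l$ in $\{3,5,\dots,2g-1\}$ (with $p_{l,k}=p_{k,l}$); and let $\mathbb C^{2g}$ have coordinates $\lambda_4,\lambda_6,\dots,\lambda_{4g+2}$. Any variable whose index is out of range is equal to zero. Let $\mathcal S\subset\mathbb C^{3g}\times\mathbb C^{g(g-1)/2}\times\mathbb C^{2g}$ be given by the equations, for $j,k\in\{3,5,\dots,2g-1\}$, $$\begin{aligned} b_{3,1}&=6b_{1,1}^2+4b_{1,3}+2\lambda_4,\\ b_{3,k}&=6b_{1,1}b_{1,k}+6b_{1,k+2}-p_{3,k},\\ b_{2,1}^2&=4b_{1,1}^3+4b_{1,1}b_{1,3}-4b_{1,5}+2p_{3,3}+4\lambda_4b_{1,1}+4\lambda_6,\\ b_{2,1}b_{2,k}&=4b_{1,1}^2b_{1,k}+2b_{1,3}b_{1,k}+4b_{1,1}b_{1,k+2}-2b_{1,k+4}-b_{1,1}p_{3,k}+2p_{3,k+2}-p_{5,k}+2\lambda_4b_{1,k}+2\lambda_8\delta_{3,k},\\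 b_{2,j}b_{2,k}&=4b_{1,1}b_{1,j}b_{1,k}+4b_{1,k}b_{1,j+2}+4b_{1,j}b_{1,k+2}+2p_{k+2,j+2}-b_{1,j}p_{3,k}-b_{1,k}p_{3,j}-p_{k,j+4}-p_{j,k+4}\\ &\quad+2\lambda_{j+k+4}(2\delta_{j,k}+\delta_{k,j-2}+\delta_{j,k-2}). \end{aligned}$$ These equations determine $p_{k,l}$ and $\lambda_s$ uniquely as polynomials in the $b_{i,j}$, so that $\mathcal S$ is the graph of a polynomial map on $\mathbb C^{3g}$; let $\rho:\mathbb C^{3g}\to\mathbb C^{2g}$ be the polynomial map $b\mapsto(\lambda_s(b))_s$. From now on $p_{k,l}$ denotes these polynomials, and $p_{s,1}=2b_{1,s}$. Define polynomial vector fields on $\mathbb C^{3g}$ by $$\mathcal D_1=\sum_{j}\Big(b_{2,j}\tfrac{\partial}{\partial b_{1,j}}+b_{3,j}\tfrac{\partial}{\partial b_{2,j}}+4(2b_{1,1}b_{2,j}+b_{2,1}b_{1,j}+b_{2,j+2})\tfrac{\partial}{\partial b_{3,j}}\Big),\qquad b_{2,2g+1}=0,$$ the sum being over $j\in\{1,3,\dots,2g-1\}$,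 and, for $s\in\{3,5,\dots,2g-1\}$, $$\mathcal D_s=\tfrac12\sum_{k=1}^{g}\Big(\mathcal D_1(p_{s,2k-1})\tfrac{\partial}{\partial b_{1,2k-1}}+\mathcal D_1^2(p_{s,2k-1})\tfrac{\partial}{\partial b_{2,2k-1}}+\mathcal D_1^3(p_{s,2k-1})\tfrac{\partial}{\partial b_{3,2k-1}}\Big).$$ A polynomial vector field $\mathcal D$ on $\mathbb C^{3g}$ is called projectable for $\rho$, with pushforward $L$, if $L$ is a polynomial vector field on $\mathbb C^{2g}$ with $\mathcal D(\rho^*f)=\rho^*(L(f))$ for every polynomial $f$ in $\lambda$. Then for every $s\in\{1,3,\dots,2g-1\}$ the vector field $\mathcal D_s$ is projectable for $\rho$, and its pushforward is zero: the zero vector field is a pushforward of $\mathcal D_s$, and it is the only one. -/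

import Mathlib

namespace Hyperelliptic

open MvPolynomial

/-! Indexing convention. The odd indices `1, 3, …, 2g-1` are written `2n+1` with `n = 0, …, g-1`, and
the even indices `4, 6, …, 4g+2` are written `2s+4` with `s = 0, …, 2g-1`. Throughout, an argument `n`
stands for the odd index `2n+1`, and an argument `s` of a `λ` stands for the even index `2s+4`. -/

/-- Index set of the coordinates `b_{i,j}` of `ℂ^{3g}`: the pair `(i, n)` stands for `b_{i+1,2n+1}`. -/
abbrev BIdx (g : ℕ) : Type := Fin 3 × Fin g

/-- Index set of the coordinates `p_{k,l}`, `k ≤ l` in `{3, 5, …, 2g-1}`, of `ℂ^{g(g-1)/2}`. -/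
abbrev PIdx (g : ℕ) : Type := {q : Fin g × Fin g // 0 < q.1.val ∧ q.1 ≤ q.2}

/-- The `b`-coordinates, equal to zero if the index is out of range. -/
def bExt {R : Type*} [Zero R] {g : ℕ} (b : BIdx g → R) (i : Fin 3) (n : ℕ) : R :=
  if h : n < g then b (i, ⟨n, h⟩) else 0

/-- The `p`-coordinates, extended by `p_{l,k} = p_{k,l}`, equal to zero if an index is out of range. -/
def pExt {R : Type*} [Zero R] {g : ℕ} (p : PIdx g → R) (m n : ℕ) : R :=
  if h : 0 < min m n ∧ max m n < g then
    p ⟨(⟨min m n, lt_of_le_of_lt min_le_max h.2⟩, ⟨max m n, h.2⟩), h.1,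
      (min_le_max : min m n ≤ max m n)⟩
  else 0

/-- The `λ`-coordinates, equal to zero if the index is out of range. -/
def lExt {R : Type*} [Zero R] {g : ℕ} (l : Fin (2 * g) → R) (s : ℕ) : R :=
  if h : s < 2 * g then l ⟨s, h⟩ else 0

/-- Kronecker delta. -/
def kd (m n : ℕ) : ℂ := if m = n then 1 else 0

/-- The affine variety `𝒮` in `ℂ^{3g} × ℂ^{g(g-1)/2} × ℂ^{2g}`, with coordinates `(b, p, λ)`. -/
def variety (g : ℕ) : Set ((BIdx g → ℂ) × (PIdx g → ℂ) × (Fin (2 * g) → ℂ)) :=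
  {x | let b1 := bExt x.1 0
       let b2 := bExt x.1 1
       let b3 := bExt x.1 2
       let p := pExt x.2.1
       let l := lExt x.2.2
       (b3 0 = 6 * b1 0 ^ 2 + 4 * b1 1 + 2 * l 0) ∧
       (∀ k, 1 ≤ k → k < g → b3 k = 6 * b1 0 * b1 k + 6 * b1 (k + 1) - p 1 k) ∧
       (b2 0 ^ 2 = 4 * b1 0 ^ 3 + 4 * b1 0 * b1 1 - 4 * b1 2 + 2 * p 1 1
          + 4 * l 0 * b1 0 + 4 * l 1) ∧
       (∀ k, 1 ≤ k → k < g →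
          b2 0 * b2 k = 4 * b1 0 ^ 2 * b1 k + 2 * b1 1 * b1 k + 4 * b1 0 * b1 (k + 1)
            - 2 * b1 (k + 2) - b1 0 * p 1 k + 2 * p 1 (k + 1) - p 2 k
            + 2 * l 0 * b1 k + 2 * l 2 * kd 1 k) ∧
       (∀ j k, 1 ≤ j → j < g → 1 ≤ k → k < g →
          b2 j * b2 k = 4 * b1 0 * b1 j * b1 k + 4 * b1 k * b1 (j + 1) + 4 * b1 j * b1 (k + 1)
            + 2 * p (k + 1) (j + 1) - b1 j * p 1 k - b1 k * p 1 j
            - p k (j + 2) - p j (k + 2)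
            + 2 * l (j + k + 1) * (2 * kd j k + kd (k + 1) j + kd (j + 1) k))}

/-- The ring of polynomials in the coordinates `b` of `ℂ^{3g}`. -/
abbrev BPoly (g : ℕ) : Type := MvPolynomial (BIdx g) ℂ

/-- The ring `𝒫` of polynomials in the coordinates `λ` of `ℂ^{2g}`. -/
abbrev LPoly (g : ℕ) : Type := MvPolynomial (Fin (2 * g)) ℂ

/-- `bc g i n` is the coordinate polynomial `b_{i+1,2n+1}`, zero if `n` is out of range. -/
noncomputable def bc (g : ℕ) (i : Fin 3) (n : ℕ) : BPoly g := bExt X i n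

/-- Auxiliary polynomials for solving the equations of `𝒮`. -/
noncomputable def aux (g : ℕ) (m n : ℕ) : BPoly g :=
  bc g 1 m * bc g 1 n + 8 * bc g 0 0 * bc g 0 m * bc g 0 n
    + 2 * bc g 0 n * bc g 0 (m + 1) + 2 * bc g 0 m * bc g 0 (n + 1)
    - bc g 0 m * bc g 2 n - bc g 0 n * bc g 2 m

/-- The polynomials `p_{2m+1,2n+1}` in `b` for `m ≤ n`, by recursion on `m`. The value at `m = 0` is the
convention `p_{1,s} = 2 b_{1,s}`. -/
noncomputable def pUpper (g : ℕ) : ℕ → ℕ → BPoly g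
  | 0, n => 2 * bc g 0 n
  | 1, n => 6 * bc g 0 0 * bc g 0 n + 6 * bc g 0 (n + 1) - bc g 2 n
  | m + 2, n => 2 * pUpper g (m + 1) (n + 1) - pUpper g m (n + 2) - aux g m n

/-- The polynomials `p_{2m+1,2n+1} = p_{2n+1,2m+1}` in `b`, with `p_{s,1} = 2 b_{1,s}`. -/
noncomputable def pPoly (g : ℕ) (m n : ℕ) : BPoly g := pUpper g (min m n) (max m n)

/-- The polynomials `λ_{2s+4}` in `b`. -/
noncomputable def lPoly (g : ℕ) (s : ℕ) : BPoly g :=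
  if s = 0 then C (1 / 2) * bc g 2 0 - 3 * bc g 0 0 ^ 2 - 2 * bc g 0 1
  else
    let m := (s - 1) / 2
    if s % 2 = 1 then
      C (1 / 4) * (aux g m m - 2 * pPoly g (m + 1) (m + 1) + 2 * pPoly g m (m + 2))
    else
      C (1 / 2) * (aux g m (m + 1) - pPoly g (m + 1) (m + 2) + pPoly g m (m + 3))

/-- The polynomial map `ρ : ℂ^{3g} → ℂ^{2g}`, given by its components. -/
noncomputable def rho (g : ℕ) : Fin (2 * g) → BPoly g := fun s => lPoly g s

/-- `ρ^* : 𝒫 → ℂ[b]`, the pullback of polynomials along `ρ`. -/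
noncomputable def rhoPullback (g : ℕ) : LPoly g →ₐ[ℂ] BPoly g := aeval (rho g)

/-- The polynomial vector field `𝒟_1` on `ℂ^{3g}`. -/
noncomputable def D1 (g : ℕ) : Derivation ℂ (BPoly g) (BPoly g) :=
  mkDerivation ℂ fun q : BIdx g =>
    ![bc g 1 q.2,
      bc g 2 q.2,
      4 * (2 * bc g 0 0 * bc g 1 q.2 + bc g 1 0 * bc g 0 q.2 + bc g 1 (q.2 + 1))] q.1

/-- The polynomial vector fields `𝒟_{2m+1}` on `ℂ^{3g}`. -/
noncomputable def D (g : ℕ) (m : Fin g) : Derivation ℂ (BPoly g) (BPoly g) :=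
  if m.val = 0 then D1 g
  else
    mkDerivation ℂ fun q : BIdx g =>
      C (1 / 2) *
        ![D1 g (pPoly g m q.2),
          D1 g (D1 g (pPoly g m q.2)),
          D1 g (D1 g (D1 g (pPoly g m q.2)))] q.1

/-- The vector field `L` on `ℂ^{2g}` is a pushforward of the vector field `V` on `ℂ^{3g}` for `ρ`:
`V (ρ^* f) = ρ^* (L f)` for every polynomial `f`. -/
def IsPushforward (g : ℕ) (V : Derivation ℂ (BPoly g) (BPoly g))
    (L : Derivation ℂ (LPoly g) (LPoly g)) : Prop :=
  ∀ f : LPoly g, V (rhoPullback g f) = rhoPullback g (L f)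

/-- The vector field `V` on `ℂ^{3g}` is projectable for `ρ`. -/
def IsProjectable (g : ℕ) (V : Derivation ℂ (BPoly g) (BPoly g)) : Prop :=
  ∃ L : Derivation ℂ (LPoly g) (LPoly g), IsPushforward g V L

/-! Sanity check: `𝒮` is the graph of the polynomial map `b ↦ (p(b), λ(b))` over `ℂ^{3g}`. -/

theorem eval_bc {g : ℕ} (b : BIdx g → ℂ) (i : Fin 3) (n : ℕ) :
    eval b (bc g i n) = bExt b i n := by
  unfold bc bExt
  split_ifs <;> simp

theorem bExt_of_le {g : ℕ} (b : BIdx g → ℂ) (i : Fin 3) {n : ℕ} (h : g ≤ n) :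
    bExt b i n = 0 := by
  simp [bExt, not_lt.mpr h]

theorem eval_aux {g : ℕ} (b : BIdx g → ℂ) (m n : ℕ) :
    eval b (aux g m n) = bExt b 1 m * bExt b 1 n + 8 * bExt b 0 0 * bExt b 0 m * bExt b 0 n
      + 2 * bExt b 0 n * bExt b 0 (m + 1) + 2 * bExt b 0 m * bExt b 0 (n + 1)
      - bExt b 0 m * bExt b 2 n - bExt b 0 n * bExt b 2 m := by
  simp [aux, eval_bc]

theorem eval_pUpper_zero {g : ℕ} (b : BIdx g → ℂ) (n : ℕ) :
    eval b (pUpper g 0 n) = 2 * bExt b 0 n := by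
  simp [pUpper, eval_bc]

theorem eval_pUpper_one {g : ℕ} (b : BIdx g → ℂ) (n : ℕ) :
    eval b (pUpper g 1 n)
      = 6 * bExt b 0 0 * bExt b 0 n + 6 * bExt b 0 (n + 1) - bExt b 2 n := by
  simp [pUpper, eval_bc]

theorem eval_pUpper_add_two {g : ℕ} (b : BIdx g → ℂ) (m n : ℕ) :
    eval b (pUpper g (m + 2) n) = 2 * eval b (pUpper g (m + 1) (n + 1))
      - eval b (pUpper g m (n + 2)) - eval b (aux g m n) := by
  simp [pUpper]

theorem eval_pUpper_of_le {g : ℕ} (b : BIdx g → ℂ) (m : ℕ) :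
    ∀ n, g ≤ n → eval b (pUpper g m n) = 0 := by
  induction m using Nat.twoStepInduction with
  | zero => intro n h; simp [eval_pUpper_zero, bExt_of_le b _ h]
  | one =>
    intro n h
    simp [eval_pUpper_one, bExt_of_le b _ h, bExt_of_le b _ (Nat.le_succ_of_le h)]
  | more m ih1 ih2 =>
    intro n h
    rw [eval_pUpper_add_two, ih1 _ (by omega), ih2 _ (by omega), eval_aux]
    simp [bExt_of_le b _ h, bExt_of_le b _ (Nat.le_succ_of_le h)]

theorem pExt_comm {g : ℕ} (p : PIdx g → ℂ) (m n : ℕ) : pExt p m n = pExt p n m := by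
  unfold pExt
  simp only [min_comm m n, max_comm m n]

theorem pExt_of_lt {g : ℕ} (p : PIdx g → ℂ) {m n : ℕ} (h0 : 0 < m) (h : m ≤ n) (hn : n < g) :
    pExt p m n = p ⟨(⟨m, lt_of_le_of_lt h hn⟩, ⟨n, hn⟩), h0, h⟩ := by
  unfold pExt
  simp [h, h0, hn]

theorem pExt_of_le {g : ℕ} (p : PIdx g → ℂ) (m : ℕ) {n : ℕ} (h : g ≤ n) : pExt p m n = 0 := by
  unfold pExt
  rw [dif_neg]
  intro h'
  have := le_max_right m n
  omega

theorem pPoly_comm (g m n : ℕ) : pPoly g m n = pPoly g n m := by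
  simp only [pPoly, min_comm m n, max_comm m n]

theorem pPoly_of_le {g m n : ℕ} (h : m ≤ n) : pPoly g m n = pUpper g m n := by
  simp [pPoly, h]

theorem lPoly_zero (g : ℕ) :
    lPoly g 0 = C (1 / 2) * bc g 2 0 - 3 * bc g 0 0 ^ 2 - 2 * bc g 0 1 := by
  simp [lPoly]

theorem lPoly_odd (g m : ℕ) : lPoly g (2 * m + 1)
    = C (1 / 4) * (aux g m m - 2 * pUpper g (m + 1) (m + 1) + 2 * pUpper g m (m + 2)) := by
  have h1 : (2 * m + 1 - 1) / 2 = m := by omega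
  have h2 : (2 * m + 1) % 2 = 1 := by omega
  simp only [lPoly, h1, h2, if_true, Nat.succ_ne_zero, if_false]
  rw [pPoly_of_le (le_refl _), pPoly_of_le (by omega)]

theorem lPoly_even (g m : ℕ) : lPoly g (2 * m + 2)
    = C (1 / 2) * (aux g m (m + 1) - pUpper g (m + 1) (m + 2) + pUpper g m (m + 3)) := by
  have h1 : (2 * m + 2 - 1) / 2 = m := by omega
  have h2 : (2 * m + 2) % 2 = 0 := by omega
  simp only [lPoly, h1, h2, Nat.succ_ne_zero, if_false, Nat.zero_ne_one]
  rw [pPoly_of_le (by omega), pPoly_of_le (by omega)]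

/-- A point of `𝒮` is the same as a point `b` together with the values at `b` of the polynomials
`p_{k,l}` and of the components `λ_s` of `ρ`. -/
theorem mem_variety_iff (g : ℕ) (b : BIdx g → ℂ) (p : PIdx g → ℂ) (l : Fin (2 * g) → ℂ) :
    (b, p, l) ∈ variety g ↔
      (∀ q : PIdx g, p q = eval b (pPoly g q.1.1 q.1.2)) ∧ ∀ s, l s = eval b (rho g s) := by
  rcases Nat.eq_zero_or_pos g with rfl | hg
  · simp [variety, bExt, pExt, lExt, PIdx]
  have key : (b, p, l) ∈ variety g ↔
      (∀ m n, 1 ≤ m → m ≤ n → n < g → pExt p m n = eval b (pUpper g m n)) ∧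
        ∀ s, s < 2 * g → lExt l s = eval b (lPoly g s) := by
    constructor
    · rintro ⟨e1, e2, e3, e4, e5⟩
      dsimp only at e1 e2 e3 e4 e5
      have hp : ∀ m n, 1 ≤ m → m ≤ n → pExt p m n = eval b (pUpper g m n) := by
        intro m
        induction m using Nat.twoStepInduction with
        | zero => intro n h; omega
        | one =>
          intro n h1 h2
          rcases Nat.lt_or_ge n g with hn | hn
          · rw [eval_pUpper_one]
            linear_combination e2 n h2 hn
          · rw [pExt_of_le p _ hn, eval_pUpper_of_le b _ _ hn]
        | more m ih1 ih2 =>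
          intro n h1 h2
          rcases Nat.lt_or_ge n g with hn | hn
          · rw [eval_pUpper_add_two, ← ih2 (n + 1) (by omega) (by omega), eval_aux]
            rcases Nat.eq_zero_or_pos m with rfl | hm
            · rw [eval_pUpper_zero]
              have h4 := e4 n (by omega) hn
              have h2' := e2 n (by omega) hn
              have hk : kd 1 n = 0 := by rw [kd, if_neg (by omega)]
              rw [hk] at h4
              simp only [zero_add] at h4 h2' e1 ⊢
              linear_combination h4 - bExt b 0 0 * h2' - bExt b 0 n * e1
            · rw [← ih1 (n + 2) (by omega) (by omega)]
              have h5 := e5 m n hm (by omega) (by omega) hn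
              have hk1 : kd m n = 0 := by rw [kd, if_neg (by omega)]
              have hk2 : kd (n + 1) m = 0 := by rw [kd, if_neg (by omega)]
              have hk3 : kd (m + 1) n = 0 := by rw [kd, if_neg (by omega)]
              rw [hk1, hk2, hk3, pExt_comm p (n + 1), pExt_comm p n] at h5
              have hm' := e2 m hm (by omega)
              have hn' := e2 n (by omega) hn
              linear_combination h5 - bExt b 0 m * hn' - bExt b 0 n * hm'
          · rw [pExt_of_le p _ hn, eval_pUpper_of_le b _ _ hn]
      refine ⟨fun m n h1 h2 _ => hp m n h1 h2, fun s hs => ?_⟩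
      rcases Nat.even_or_odd' s with ⟨m, rfl | rfl⟩
      · rcases m with _ | m
        · simp only [mul_zero, lPoly_zero, map_sub, map_mul, eval_C, eval_bc, map_pow, map_ofNat]
          linear_combination (-1 / 2 : ℂ) * e1
        · rw [show 2 * (m + 1) = 2 * m + 2 by ring, lPoly_even]
          simp only [map_sub, map_add, map_mul, eval_C, eval_aux]
          have hm' := e2 (m + 1) (by omega) (by omega)
          rw [← hp (m + 1) (m + 2) (by omega) (by omega)]
          rcases Nat.eq_zero_or_pos m with rfl | hm
          · have h4 := e4 1 (by omega) (by omega)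
            have hk : kd 1 1 = 1 := by rw [kd, if_pos rfl]
            rw [hk, pExt_comm p 2 1] at h4
            rw [eval_pUpper_zero]
            simp only [zero_add, mul_zero, Nat.reduceAdd] at h4 hm' e1 ⊢
            linear_combination (-1 / 2 : ℂ) * h4 + (1 / 2 : ℂ) * bExt b 0 0 * hm'
              + (1 / 2 : ℂ) * bExt b 0 1 * e1
          · have h5 := e5 m (m + 1) (by omega) (by omega) (by omega) (by omega)
            have hm0 := e2 m hm (by omega)
            rw [← hp m (m + 3) hm (by omega)]
            have hk1 : kd m (m + 1) = 0 := by rw [kd, if_neg (by omega)]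
            have hk2 : kd (m + 1 + 1) m = 0 := by rw [kd, if_neg (by omega)]
            have hk3 : kd (m + 1) (m + 1) = 1 := by rw [kd, if_pos rfl]
            rw [hk1, hk2, hk3, show m + (m + 1) + 1 = 2 * m + 2 by ring,
              pExt_comm p (m + 1 + 1)] at h5
            linear_combination (-1 / 2 : ℂ) * h5 + (1 / 2 : ℂ) * bExt b 0 m * hm'
              + (1 / 2 : ℂ) * bExt b 0 (m + 1) * hm0
      · rw [lPoly_odd]
        simp only [map_sub, map_add, map_mul, eval_C, eval_aux, map_ofNat]
        rw [← hp (m + 1) (m + 1) (by omega) (by omega)]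
        rcases Nat.eq_zero_or_pos m with rfl | hm
        · simp only [eval_pUpper_zero, zero_add, mul_zero]
          linear_combination (-1 / 4 : ℂ) * e3 + (1 / 2 : ℂ) * bExt b 0 0 * e1
        · have h5 := e5 m m hm (by omega) hm (by omega)
          have hm' := e2 m hm (by omega)
          rw [← hp m (m + 2) hm (by omega)]
          have hk1 : kd m m = 1 := by rw [kd, if_pos rfl]
          have hk2 : kd (m + 1) m = 0 := by rw [kd, if_neg (by omega)]
          rw [hk1, hk2, show m + m + 1 = 2 * m + 1 by ring] at h5
          linear_combination (-1 / 4 : ℂ) * h5 + (1 / 2 : ℂ) * bExt b 0 m * hm'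
    · rintro ⟨hp0, hl⟩
      have hp : ∀ m n, 1 ≤ m → m ≤ n → pExt p m n = eval b (pUpper g m n) := by
        intro m n h1 h2
        rcases Nat.lt_or_ge n g with hn | hn
        · exact hp0 m n h1 h2 hn
        · rw [pExt_of_le p _ hn, eval_pUpper_of_le b _ _ hn]
      have e1 : lExt l 0 = eval b (lPoly g 0) := hl 0 (by omega)
      simp only [lPoly_zero, map_sub, map_mul, eval_C, eval_bc, map_pow, map_ofNat] at e1
      have e2 : ∀ k, 1 ≤ k → pExt p 1 k
          = 6 * bExt b 0 0 * bExt b 0 k + 6 * bExt b 0 (k + 1) - bExt b 2 k := by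
        intro k h1
        rw [hp 1 k le_rfl h1, eval_pUpper_one]
      have hodd : ∀ m, m < g → lExt l (2 * m + 1) = eval b (lPoly g (2 * m + 1)) :=
        fun m hm => hl _ (by omega)
      have heven : ∀ m, m + 1 < g → lExt l (2 * m + 2) = eval b (lPoly g (2 * m + 2)) :=
        fun m hm => hl _ (by omega)
      have hrec : ∀ m n, 1 ≤ m → m + 2 ≤ n → pExt p (m + 2) n
          = 2 * pExt p (m + 1) (n + 1) - pExt p m (n + 2) - eval b (aux g m n) := by
        intro m n h1 h2
        rw [hp _ _ (by omega) h2, eval_pUpper_add_two, hp _ _ (by omega) (by omega),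
          hp _ _ h1 (by omega)]
      have e5 : ∀ j k, 1 ≤ j → j ≤ k → k < g →
          bExt b 1 j * bExt b 1 k = 4 * bExt b 0 0 * bExt b 0 j * bExt b 0 k
            + 4 * bExt b 0 k * bExt b 0 (j + 1) + 4 * bExt b 0 j * bExt b 0 (k + 1)
            + 2 * pExt p (k + 1) (j + 1) - bExt b 0 j * pExt p 1 k - bExt b 0 k * pExt p 1 j
            - pExt p k (j + 2) - pExt p j (k + 2)
            + 2 * lExt l (j + k + 1) * (2 * kd j k + kd (k + 1) j + kd (j + 1) k) := by
        intro j k h1 h2 h3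
        have hj := e2 j h1
        have hk := e2 k (by omega)
        have hk2 : kd (k + 1) j = 0 := by rw [kd, if_neg (by omega)]
        rw [hk2, pExt_comm p (k + 1), pExt_comm p k]
        rcases Nat.lt_or_ge k (j + 2) with h | h
        · rcases Nat.lt_or_ge k (j + 1) with h' | h'
          · obtain rfl : k = j := by omega
            have hs := hodd k h3
            rw [lPoly_odd] at hs
            simp only [map_sub, map_add, map_mul, eval_C, eval_aux, map_ofNat] at hs
            rw [← hp _ _ (by omega) (by omega), ← hp _ _ h1 (by omega)] at hs
            have hk1 : kd k k = 1 := by rw [kd, if_pos rfl]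
            have hk3 : kd (k + 1) k = 0 := by rw [kd, if_neg (by omega)]
            rw [hk1, hk3, show k + k + 1 = 2 * k + 1 by ring, pExt_comm p (k + 2)]
            linear_combination (-4 : ℂ) * hs + 2 * bExt b 0 k * hk
          · obtain rfl : k = j + 1 := by omega
            have hs := heven j h3
            rw [lPoly_even] at hs
            simp only [map_sub, map_add, map_mul, eval_C, eval_aux] at hs
            rw [← hp _ _ (by omega) (by omega), ← hp _ _ h1 (by omega)] at hs
            have hk1 : kd j (j + 1) = 0 := by rw [kd, if_neg (by omega)]
            have hk3 : kd (j + 1) (j + 1) = 1 := by rw [kd, if_pos rfl]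
            rw [hk1, hk3, show j + (j + 1) + 1 = 2 * j + 2 by ring, pExt_comm p (j + 2)]
            linear_combination (-2 : ℂ) * hs + bExt b 0 j * hk + bExt b 0 (j + 1) * hj
        · have hr := hrec j k h1 h
          rw [eval_aux] at hr
          have hk1 : kd j k = 0 := by rw [kd, if_neg (by omega)]
          have hk3 : kd (j + 1) k = 0 := by rw [kd, if_neg (by omega)]
          rw [hk1, hk3]
          linear_combination hr + bExt b 0 j * hk + bExt b 0 k * hj
      refine ⟨?_, ?_, ?_, ?_, ?_⟩
      · dsimp only
        linear_combination (-2 : ℂ) * e1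
      · intro k h1 _
        dsimp only
        linear_combination e2 k h1
      · dsimp only
        have hs := hodd 0 hg
        rw [lPoly_odd] at hs
        simp only [map_sub, map_add, map_mul, eval_C, eval_aux, map_ofNat] at hs
        rw [← hp _ _ (by omega) (by omega), eval_pUpper_zero] at hs
        simp only [zero_add, mul_zero] at hs
        linear_combination (-4 : ℂ) * hs + (-4 : ℂ) * bExt b 0 0 * e1
      · intro k h1 h2
        dsimp only
        have hk := e2 k h1
        rcases Nat.lt_or_ge k 2 with h | h
        · obtain rfl : k = 1 := by omega
          have hs := heven 0 h2
          rw [lPoly_even] at hs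
          simp only [map_sub, map_add, map_mul, eval_C, eval_aux] at hs
          rw [← hp _ _ (by omega) (by omega), eval_pUpper_zero] at hs
          have hk1 : kd 1 1 = 1 := by rw [kd, if_pos rfl]
          rw [hk1, pExt_comm p 2 1]
          simp only [zero_add, mul_zero, Nat.reduceAdd] at hs hk ⊢
          linear_combination (-2 : ℂ) * hs + bExt b 0 0 * hk - 2 * bExt b 0 1 * e1
        · have hr : pExt p 2 k
              = 2 * pExt p 1 (k + 1) - 2 * bExt b 0 (k + 2) - eval b (aux g 0 k) := by
            rw [hp _ _ (by omega) h, eval_pUpper_add_two, hp _ _ (by omega) (by omega),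
              eval_pUpper_zero]
          rw [eval_aux] at hr
          have hk1 : kd 1 k = 0 := by rw [kd, if_neg (by omega)]
          rw [hk1]
          simp only [zero_add] at hr
          linear_combination hr + bExt b 0 0 * hk - 2 * bExt b 0 k * e1
      · intro j k h1 h2 h3 h4
        dsimp only
        rcases Nat.le_total j k with h | h
        · exact e5 j k h1 h h4
        · have := e5 k j h3 h h2
          rw [pExt_comm p (j + 1)] at this
          have hk1 : kd j k = kd k j := by simp only [kd, eq_comm]
          rw [hk1, show j + k + 1 = k + j + 1 by ring]
          linear_combination this
  rw [key]
  constructor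
  · rintro ⟨h1, h2⟩
    refine ⟨?_, fun s => ?_⟩
    · rintro ⟨⟨⟨m, hm⟩, ⟨n, hn⟩⟩, h0, h⟩
      have h' : m ≤ n := h
      have := h1 m n h0 h' hn
      rw [pExt_of_lt p h0 h' hn] at this
      rw [this, pPoly_of_le h']
    · have := h2 s s.2
      simpa [lExt, rho] using this
  · rintro ⟨h1, h2⟩
    refine ⟨fun m n h0 h hn => ?_, fun s hs => ?_⟩
    · rw [pExt_of_lt p h0 h hn, h1, pPoly_of_le h]
    · rw [lExt, dif_pos hs, h2, rho]

end Hyperelliptic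

/-! Write `U = 1 - ∑ b_{1,2n+1} X^(n+1)` and let primes denote `D1`, acting on coefficients. With `Q
= 1 + 2 b_{1,1} X`, the field `D1` becomes the linear equation `X U''' = 4 Q U' + 4 b_{2,1} X U`,
satisfied by products of two solutions of a Schrödinger equation with potential `Q / X`. Its
quadratic first integral `4 Q U² - 2 X U U'' + X U'²` equals `4 + 4 X² ∑ λ_{2s+4} X^s`
(`firstIntegral`), so the components of `ρ` are the coefficients of the spectral curve.

The other fields are of Lax type: if `a` is the truncation of `U` at degree `m`, then `X^m D_{2m+1}
U = a U' - a' U` (`X_pow_mul_flow_eq`). This rests on `D1 p_{2m+1,2n+1}` being `-2` times a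
coefficient of the divided Wronskian of `U` (`D1_pUpper`). The truncation solves the same linear
equation up to one monomial, and that defect cancels the derivative of `b_{1,1}` inside `Q`; hence
every `λ` is killed (`D_lPoly`).

Uniqueness is injectivity of `ρ^*`: the image of `ρ` contains the dense set `λ_{4g+2} ≠ 0`
(`exists_eval_rho_eq`), where on `b_{1,j} = 0` the equations reduce to taking a square root of a
power series. -/

namespace Hyperelliptic

open MvPolynomial

/-! ### Derivations acting coefficientwise on power series. -/

section PowerSeries

variable {R : Type*} [CommRing R] [Algebra ℂ R]

/-- The coefficientwise action of a derivation on power series. -/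
noncomputable def coeffwise (V : Derivation ℂ R R) (f : PowerSeries R) : PowerSeries R :=
  PowerSeries.mk fun n => V (PowerSeries.coeff n f)

variable (V : Derivation ℂ R R)

theorem coeff_coeffwise (f : PowerSeries R) (n : ℕ) :
    PowerSeries.coeff n (coeffwise V f) = V (PowerSeries.coeff n f) := by
  simp [coeffwise]

theorem coeffwise_add (f h : PowerSeries R) :
    coeffwise V (f + h) = coeffwise V f + coeffwise V h := by
  ext n; simp [coeff_coeffwise]

theorem coeffwise_sub (f h : PowerSeries R) :
    coeffwise V (f - h) = coeffwise V f - coeffwise V h := by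
  ext n; simp [coeff_coeffwise]

theorem coeffwise_mul (f h : PowerSeries R) :
    coeffwise V (f * h) = coeffwise V f * h + f * coeffwise V h := by
  ext n
  simp only [coeff_coeffwise, PowerSeries.coeff_mul, map_add, map_sum, Derivation.leibniz,
    smul_eq_mul, Finset.sum_add_distrib]
  rw [add_comm]
  congr 1
  exact Finset.sum_congr rfl fun _ _ => mul_comm _ _

theorem coeffwise_C (r : R) : coeffwise V (PowerSeries.C r) = PowerSeries.C (V r) := by
  ext n
  simp only [coeff_coeffwise, PowerSeries.coeff_C]
  split_ifs <;> simp

theorem coeffwise_X_pow (k : ℕ) : coeffwise V (PowerSeries.X ^ k : PowerSeries R) = 0 := by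
  ext n
  simp only [coeff_coeffwise, PowerSeries.coeff_X_pow]
  split_ifs <;> simp

theorem coeffwise_X : coeffwise V (PowerSeries.X : PowerSeries R) = 0 := by
  simpa using coeffwise_X_pow V 1

theorem coeffwise_natCast (k : ℕ) : coeffwise V (k : PowerSeries R) = 0 := by
  rw [← map_natCast (PowerSeries.C (R := R)), coeffwise_C]
  simp

theorem coeffwise_one : coeffwise V (1 : PowerSeries R) = 0 := by
  simpa using coeffwise_natCast V 1

end PowerSeries

variable (g : ℕ)

/-! ### The field `D1` on coordinates. -/

theorem bc_of_le (i : Fin 3) {n : ℕ} (h : g ≤ n) : bc g i n = 0 := by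
  simp [bc, bExt, not_lt.mpr h]

theorem bc_of_lt (i : Fin 3) {n : ℕ} (h : n < g) : bc g i n = X (i, ⟨n, h⟩) := by
  simp [bc, bExt, h]

theorem D1_bc_zero (n : ℕ) : D1 g (bc g 0 n) = bc g 1 n := by
  rcases Nat.lt_or_ge n g with h | h
  · simp [bc_of_lt g 0 h, D1, mkDerivation_X]
  · simp [bc_of_le g _ h]

theorem D1_bc_one (n : ℕ) : D1 g (bc g 1 n) = bc g 2 n := by
  rcases Nat.lt_or_ge n g with h | h
  · simp [bc_of_lt g 1 h, D1, mkDerivation_X]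
  · simp [bc_of_le g _ h]

theorem D1_bc_two (n : ℕ) : D1 g (bc g 2 n)
    = 4 * (2 * bc g 0 0 * bc g 1 n + bc g 1 0 * bc g 0 n + bc g 1 (n + 1)) := by
  rcases Nat.lt_or_ge n g with h | h
  · simp [bc_of_lt g 2 h, D1, mkDerivation_X]
  · simp [bc_of_le g _ h, bc_of_le g _ (Nat.le_succ_of_le h)]

/-! ### The divided Wronskian and the derivatives of the `p`. -/

/-- The coefficients of `c - ∑ b_{i+1,2n+1} X^(n+1)`. -/
noncomputable def shiftNeg (c : BPoly g) (i : Fin 3) : ℕ → BPoly g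
  | 0 => c
  | n + 1 => -bc g i n

/-- The antisymmetric form `u_i u'_j - u'_i u_j` in the coefficients of
`U = 1 - ∑ b_{1,2n+1} X^(n+1)` and of its derivative along `D1`. -/
noncomputable def wronsk (i j : ℕ) : BPoly g :=
  shiftNeg g 1 0 i * shiftNeg g 0 1 j - shiftNeg g 0 1 i * shiftNeg g 1 0 j

theorem wronsk_swap (i j : ℕ) : wronsk g i j = -wronsk g j i := by
  unfold wronsk; ring

/-- The coefficients of the quotient of the Wronskian `U(ξ) U'(η) - U'(ξ) U(η)` by `η - ξ`. -/
noncomputable def flowCoeff (m n : ℕ) : BPoly g :=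
  ∑ i ∈ Finset.range (m + 1), wronsk g i (m + n + 1 - i)

theorem flowCoeff_zero (n : ℕ) : flowCoeff g 0 n = -bc g 1 n := by
  simp [flowCoeff, wronsk, shiftNeg]

/-- Comparison of coefficients in "quotient times `η - ξ` equals Wronskian". -/
theorem flowCoeff_succ (m n : ℕ) :
    flowCoeff g (m + 1) n = flowCoeff g m (n + 1) + wronsk g (m + 1) (n + 1) := by
  unfold flowCoeff
  rw [Finset.sum_range_succ]
  congr 2
  · funext i; congr 1; omega
  · omega

/-- For `m ≤ n` the two sums differ by the block `m < i ≤ n`, on which reflecting `i` to `m + n + 1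
- i` changes the sign of `wronsk`; the block equals its own negative. -/
theorem flowCoeff_symm (m n : ℕ) : flowCoeff g m n = flowCoeff g n m := by
  wlog h : m ≤ n
  · exact (this g n m (by omega)).symm
  unfold flowCoeff
  rw [← Finset.sum_range_add_sum_Ico _ (show m + 1 ≤ n + 1 by omega), add_comm n m]
  have key : ∑ i ∈ Finset.Ico (m + 1) (n + 1), wronsk g i (m + n + 1 - i) = 0 := by
    have hr : ∑ i ∈ Finset.Ico (m + 1) (n + 1), wronsk g i (m + n + 1 - i)
        = ∑ i ∈ Finset.Ico (m + 1) (n + 1), wronsk g (m + n + 1 - i) i := by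
      refine Finset.sum_bij' (fun i _ => m + n + 1 - i) (fun i _ => m + n + 1 - i) ?_ ?_ ?_ ?_ ?_
      all_goals intro i hi; simp only [Finset.mem_Ico] at hi ⊢
      · omega
      · omega
      · omega
      · omega
      · congr 1; omega
    have h2 : ∑ i ∈ Finset.Ico (m + 1) (n + 1), wronsk g i (m + n + 1 - i)
        = -∑ i ∈ Finset.Ico (m + 1) (n + 1), wronsk g i (m + n + 1 - i) := by
      conv_lhs => rw [hr]
      rw [← Finset.sum_neg_distrib]
      exact Finset.sum_congr rfl fun i _ => wronsk_swap g _ _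
    exact self_eq_neg.mp h2
  rw [key, add_zero]

theorem D1_aux (m n : ℕ) : D1 g (aux g m n)
    = 2 * (wronsk g (m + 2) (n + 1) - wronsk g (m + 1) (n + 2)) := by
  have h2 : D1 g (2 : BPoly g) = 0 := by exact_mod_cast (D1 g).map_natCast 2
  have h8 : D1 g (8 : BPoly g) = 0 := by exact_mod_cast (D1 g).map_natCast 8
  simp only [aux, map_add, map_sub, Derivation.leibniz, smul_eq_mul, D1_bc_zero, D1_bc_one,
    D1_bc_two, h2, h8, wronsk, shiftNeg]
  ring

/-- The recursion for `pUpper` prescribes its second difference along antidiagonals as `-aux`. By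
`D1_aux`, applying `D1` gives the second difference of `-2 * flowCoeff`, and the cases `m = 0, 1`
agree. -/
theorem D1_pUpper (m : ℕ) : ∀ n, D1 g (pUpper g m n) = -2 * flowCoeff g m n := by
  have h2 : D1 g (2 : BPoly g) = 0 := by exact_mod_cast (D1 g).map_natCast 2
  have h6 : D1 g (6 : BPoly g) = 0 := by exact_mod_cast (D1 g).map_natCast 6
  induction m using Nat.twoStepInduction with
  | zero =>
    intro n
    simp only [pUpper, Derivation.leibniz, smul_eq_mul, h2, D1_bc_zero, flowCoeff_zero]
    ring
  | one =>
    intro n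
    simp only [pUpper, map_add, map_sub, Derivation.leibniz, smul_eq_mul, h6, D1_bc_zero,
      D1_bc_two, flowCoeff_succ g 0, flowCoeff_zero, wronsk, shiftNeg]
    ring
  | more m ih1 ih2 =>
    intro n
    simp only [pUpper, map_sub, Derivation.leibniz, smul_eq_mul, h2, ih1, ih2, D1_aux,
      flowCoeff_succ]
    ring

theorem D1_pPoly (m n : ℕ) : D1 g (pPoly g m n) = -2 * flowCoeff g m n := by
  rw [pPoly, D1_pUpper]
  rcases Nat.le_total m n with h | h
  · rw [min_eq_left h, max_eq_right h]
  · rw [min_eq_right h, max_eq_left h, flowCoeff_symm]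

theorem flowCoeff_of_le (m : ℕ) {n : ℕ} (h : g ≤ n) : flowCoeff g m n = 0 := by
  refine Finset.sum_eq_zero fun i hi => ?_
  have := Finset.mem_range.mp hi
  obtain ⟨j, hj⟩ : ∃ j, m + n + 1 - i = j + 1 := ⟨m + n - i, by omega⟩
  rw [wronsk, hj]
  simp [shiftNeg, bc_of_le g _ (show g ≤ j by omega)]

/-! ### The fields `D g m` on coordinates. -/

theorem C_half_mul_neg_two (f : BPoly g) : C (1 / 2) * (-2 * f) = -f := by
  have h : (C (1 / 2) : BPoly g) * 2 = 1 := by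
    rw [show (2 : BPoly g) = C 2 from (map_ofNat C 2).symm, ← C_mul]
    norm_num
  linear_combination (-f) * h

theorem D1_C_half_mul (f : BPoly g) : C (1 / 2) * D1 g f = D1 g (C (1 / 2) * f) := by
  rw [← smul_eq_C_mul, ← smul_eq_C_mul, Derivation.map_smul]

theorem D_bc_zero (m : Fin g) (n : ℕ) : D g m (bc g 0 n) = -flowCoeff g m n := by
  rcases Nat.lt_or_ge n g with h | h
  · unfold D
    split_ifs with hm
    · rw [D1_bc_zero, hm, flowCoeff_zero, neg_neg]
    · simp only [bc_of_lt g 0 h, mkDerivation_X, Matrix.cons_val_zero, D1_pPoly,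
        C_half_mul_neg_two]
  · simp [bc_of_le g _ h, flowCoeff_of_le g _ h]

/-- With `D_bc_two`, this is the only commutation of `D g m` with `D1` that is needed; it is built
into the definition of the fields. -/
theorem D_bc_one (m : Fin g) (n : ℕ) : D g m (bc g 1 n) = D1 g (D g m (bc g 0 n)) := by
  rw [D_bc_zero]
  rcases Nat.lt_or_ge n g with h | h
  · unfold D
    split_ifs with hm
    · rw [hm, flowCoeff_zero, neg_neg]
    · simp only [bc_of_lt g 1 h, mkDerivation_X, Matrix.cons_val_one, Matrix.cons_val_zero,
        D1_pPoly, D1_C_half_mul, C_half_mul_neg_two]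
  · simp [bc_of_le g _ h, flowCoeff_of_le g _ h]

theorem D_bc_two (m : Fin g) (n : ℕ) : D g m (bc g 2 n) = D1 g (D1 g (D g m (bc g 0 n))) := by
  rw [D_bc_zero]
  rcases Nat.lt_or_ge n g with h | h
  · unfold D
    split_ifs with hm
    · rw [hm, flowCoeff_zero, neg_neg, D1_bc_one]
    · simp only [bc_of_lt g 2 h, mkDerivation_X, Matrix.cons_val,
        D1_pPoly, D1_C_half_mul, C_half_mul_neg_two]
  · simp [bc_of_le g _ h, flowCoeff_of_le g _ h]

/-! ### Closed convolution formula for the `λ`. -/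

/-- The second-difference recursion summed once along the antidiagonal of constant `m + n`. -/
theorem pUpper_succ_sub (m : ℕ) : ∀ n, pUpper g (m + 1) n - pUpper g m (n + 1)
    = 6 * bc g 0 0 * bc g 0 (m + n) + 4 * bc g 0 (m + n + 1) - bc g 2 (m + n)
      - ∑ i ∈ Finset.range m, aux g i (m + n - 1 - i) := by
  induction m with
  | zero => intro n; simp [pUpper]; ring
  | succ m ih =>
    intro n
    have := ih (n + 1)
    rw [Finset.sum_range_succ, show m + 1 + n - 1 - m = n by omega,
      show m + 1 + n = m + (n + 1) by ring, pUpper]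
    linear_combination this

theorem aux_symm (m n : ℕ) : aux g m n = aux g n m := by
  unfold aux; ring

theorem sum_aux_split (s a n : ℕ) (h : a + n = s) :
    ∑ i ∈ Finset.range s, aux g i (s - 1 - i)
      = ∑ i ∈ Finset.range a, aux g i (s - 1 - i) + ∑ i ∈ Finset.range n, aux g i (s - 1 - i) := by
  subst h
  rw [Finset.sum_range_add, ← Finset.sum_range_reflect (fun i => aux g (a + i) _) n]
  refine congrArg₂ (· + ·) rfl (Finset.sum_congr rfl fun i hi => ?_)
  have := Finset.mem_range.mp hi
  rw [aux_symm]
  exact congrArg₂ (aux g) (by omega) (by omega)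

/-- The definition of `lPoly` involves a first difference of `p` at the middle of an antidiagonal.
`pUpper_succ_sub` turns it into half of a palindromic sum, and `sum_aux_split` reassembles the
whole, removing the parity distinction. -/
theorem four_mul_lPoly (s : ℕ) : 4 * lPoly g s = ∑ i ∈ Finset.range s, aux g i (s - 1 - i)
      - 2 * (6 * bc g 0 0 * bc g 0 s + 4 * bc g 0 (s + 1) - bc g 2 s) := by
  have h2 : (C (1 / 2) : BPoly g) * 2 = 1 := by
    rw [show (2 : BPoly g) = C 2 from (map_ofNat C 2).symm, ← C_mul]
    norm_num
  have h4 : (C (1 / 4) : BPoly g) * 4 = 1 := by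
    rw [show (4 : BPoly g) = C 4 from (map_ofNat C 4).symm, ← C_mul]
    norm_num
  rcases Nat.even_or_odd' s with ⟨m, rfl | rfl⟩
  · rcases m with _ | m
    · simp only [mul_zero, lPoly_zero, Finset.range_zero, Finset.sum_empty]
      generalize (C (1 / 2) : BPoly g) = c at h2 ⊢
      linear_combination 2 * bc g 2 0 * h2
    · have hp := pUpper_succ_sub g m (m + 2)
      rw [show 2 * (m + 1) = 2 * m + 2 by ring, lPoly_even,
        sum_aux_split g (2 * m + 2) (m + 1) (m + 1) (by ring), Finset.sum_range_succ, show 2 * m + 2 - 1 - m = m + 1 by omega]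
      rw [show m + (m + 2) = 2 * m + 2 by ring] at hp
      generalize (C (1 / 2) : BPoly g) = c at h2 ⊢
      linear_combination (-2) * hp
        + 2 * (aux g m (m + 1) - pUpper g (m + 1) (m + 2) + pUpper g m (m + 3)) * h2
  · have hp := pUpper_succ_sub g m (m + 1)
    rw [lPoly_odd, sum_aux_split g (2 * m + 1) (m + 1) m (by ring), Finset.sum_range_succ,
      show 2 * m + 1 - 1 - m = m by omega]
    rw [show m + (m + 1) = 2 * m + 1 by ring] at hp
    generalize (C (1 / 4) : BPoly g) = c at h4 ⊢
    linear_combination (-2) * hp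
      + (aux g m m - 2 * pUpper g (m + 1) (m + 1) + 2 * pUpper g m (m + 2)) * h4

/-! ### Generating series and the spectral curve. -/

/-- The series `∑ b_{i+1,2n+1} X^n`. -/
noncomputable def bSeries (i : Fin 3) : PowerSeries (BPoly g) := PowerSeries.mk (bc g i)

/-- The series `c - ∑ b_{i+1,2n+1} X^(n+1)`. -/
noncomputable def uSeries (c : BPoly g) (i : Fin 3) : PowerSeries (BPoly g) :=
  PowerSeries.mk (shiftNeg g c i)

/-- The truncation of `uSeries` to degree at most `m`. -/
noncomputable def uTrunc (m : ℕ) (c : BPoly g) (i : Fin 3) : PowerSeries (BPoly g) :=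
  PowerSeries.mk fun k => if k ≤ m then shiftNeg g c i k else 0

theorem uSeries_eq (c : BPoly g) (i : Fin 3) :
    uSeries g c i = PowerSeries.C c - PowerSeries.X * bSeries g i := by
  ext1 n
  rcases n with _ | n
  · simp [uSeries, shiftNeg]
  · simp [uSeries, shiftNeg, bSeries, PowerSeries.coeff_succ_X_mul]

theorem sum_range_eq_coeff_mul (f h : ℕ → BPoly g) (s : ℕ) :
    ∑ i ∈ Finset.range (s + 1), f i * h (s - i)
      = PowerSeries.coeff s (PowerSeries.mk f * PowerSeries.mk h) := by
  rw [PowerSeries.coeff_mul, Finset.Nat.sum_antidiagonal_eq_sum_range_succ_mk]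
  simp

/-- The spectral curve series as the first integral of the linear equation satisfied by `U`. -/
theorem firstIntegral :
    4 * (2 * PowerSeries.C (bc g 0 0) * PowerSeries.X + 1) * (uSeries g 1 0 * uSeries g 1 0)
      - 2 * PowerSeries.X * (uSeries g 1 0 * uSeries g 0 2)
      + PowerSeries.X * (uSeries g 0 1 * uSeries g 0 1)
      = 4 + PowerSeries.X ^ 2 * PowerSeries.mk fun s => 4 * lPoly g s := by
  set B : PowerSeries (BPoly g) := PowerSeries.mk fun n => bc g 0 (n + 1) with hB
  have h0 : bSeries g 0 = PowerSeries.C (bc g 0 0) + PowerSeries.X * B := by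
    ext1 n
    rcases n with _ | n
    · simp [bSeries]
    · simp [bSeries, hB, PowerSeries.coeff_succ_X_mul]
  have hl : (PowerSeries.mk fun s => 4 * lPoly g s) = PowerSeries.X *
      (bSeries g 1 * bSeries g 1 + PowerSeries.C (8 * bc g 0 0) * (bSeries g 0 * bSeries g 0)
        + PowerSeries.C 2 * (B * bSeries g 0) + PowerSeries.C 2 * (bSeries g 0 * B)
        - bSeries g 0 * bSeries g 2 - bSeries g 2 * bSeries g 0)
      - PowerSeries.C (12 * bc g 0 0) * bSeries g 0 - PowerSeries.C 8 * B
      + PowerSeries.C 2 * bSeries g 2 := by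
    ext1 s
    rw [PowerSeries.coeff_mk, four_mul_lPoly]
    rcases s with _ | s
    · simp only [bSeries, hB, map_add, map_sub, PowerSeries.coeff_C_mul, PowerSeries.coeff_mk,
        PowerSeries.coeff_zero_X_mul, Finset.range_zero, Finset.sum_empty]
      ring
    · simp only [bSeries, hB, map_add, map_sub, PowerSeries.coeff_C_mul, PowerSeries.coeff_mk,
        PowerSeries.coeff_succ_X_mul, ← sum_range_eq_coeff_mul, Nat.add_sub_cancel, aux,
        Finset.mul_sum, ← Finset.sum_add_distrib, ← Finset.sum_sub_distrib]
      -- Reorders each product as a function of `i` times a function of `s - i`, the shape of a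
      -- Cauchy product.
      have : ∀ i, bc g 1 i * bc g 1 (s - i) + 8 * bc g 0 0 * bc g 0 i * bc g 0 (s - i)
          + 2 * bc g 0 (s - i) * bc g 0 (i + 1) + 2 * bc g 0 i * bc g 0 (s - i + 1)
          - bc g 0 i * bc g 2 (s - i) - bc g 0 (s - i) * bc g 2 i
          = bc g 1 i * bc g 1 (s - i) + 8 * bc g 0 0 * (bc g 0 i * bc g 0 (s - i))
          + 2 * (bc g 0 (i + 1) * bc g 0 (s - i)) + 2 * (bc g 0 i * bc g 0 (s - i + 1))
          - bc g 0 i * bc g 2 (s - i) - bc g 2 i * bc g 0 (s - i) := fun i => by ring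
      simp only [this]
      ring
  simp only [map_mul, map_ofNat] at hl
  rw [hl]
  simp only [uSeries_eq, map_one, map_zero]
  rw [h0]
  ring

/-! ### The linear equation and the Lax form of the flows. -/

theorem coeffwise_D1_uSeries : coeffwise (D1 g) (uSeries g 1 0) = uSeries g 0 1 := by
  ext1 n
  rcases n with _ | n <;> simp [coeff_coeffwise, uSeries, shiftNeg, D1_bc_zero]

theorem coeffwise_D1_uSeries_one : coeffwise (D1 g) (uSeries g 0 1) = uSeries g 0 2 := by
  ext1 n
  rcases n with _ | n <;> simp [coeff_coeffwise, uSeries, shiftNeg, D1_bc_one]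

theorem coeffwise_D1_uTrunc (m : ℕ) : coeffwise (D1 g) (uTrunc g m 1 0) = uTrunc g m 0 1 := by
  ext1 n
  rcases n with _ | n <;>
    simp only [coeff_coeffwise, uTrunc, shiftNeg, PowerSeries.coeff_mk] <;>
    split_ifs <;> simp [D1_bc_zero]

theorem coeffwise_D1_uTrunc_one (m : ℕ) :
    coeffwise (D1 g) (uTrunc g m 0 1) = uTrunc g m 0 2 := by
  ext1 n
  rcases n with _ | n <;>
    simp only [coeff_coeffwise, uTrunc, shiftNeg, PowerSeries.coeff_mk] <;>
    split_ifs <;> simp [D1_bc_one]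

/-- The third-order equation `U''' = 4 q U' + 2 q' U` for `q = 2 b_{1,1} + 1/X`, multiplied by `X`
to clear the pole. -/
theorem X_mul_coeffwise_D1_uSeries_two :
    PowerSeries.X * coeffwise (D1 g) (uSeries g 0 2)
      = PowerSeries.C (8 * bc g 0 0) * (PowerSeries.X * uSeries g 0 1)
        + PowerSeries.C 4 * uSeries g 0 1
        + PowerSeries.C (4 * bc g 1 0) * (PowerSeries.X * uSeries g 1 0) := by
  ext1 n
  rcases n with _ | _ | n
  · simp [uSeries, shiftNeg, PowerSeries.coeff_zero_X_mul]
  · simp only [uSeries, shiftNeg, PowerSeries.coeff_succ_X_mul, coeff_coeffwise, map_add,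
      PowerSeries.coeff_C_mul, PowerSeries.coeff_mk, map_zero]
    ring
  · simp [uSeries, shiftNeg, PowerSeries.coeff_succ_X_mul, coeff_coeffwise,
      PowerSeries.coeff_C_mul, D1_bc_two, -map_mul]
    ring

/-- Truncation spoils the equation only in degree `m + 1`: there `D1_bc_two` produces a shifted term
`b_{2,2m+1}` whose counterpart in `U'` has been cut off. -/
theorem X_mul_coeffwise_D1_uTrunc_two (m : ℕ) :
    PowerSeries.X * coeffwise (D1 g) (uTrunc g m 0 2)
      = PowerSeries.C (8 * bc g 0 0) * (PowerSeries.X * uTrunc g m 0 1)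
        + PowerSeries.C 4 * uTrunc g m 0 1
        + PowerSeries.C (4 * bc g 1 0) * (PowerSeries.X * uTrunc g m 1 0)
        - PowerSeries.C (4 * bc g 1 m) * PowerSeries.X ^ (m + 1) := by
  ext1 n
  rcases n with _ | _ | n
  · simp [uTrunc, shiftNeg, PowerSeries.coeff_zero_X_mul]
  · simp only [uTrunc, shiftNeg, PowerSeries.coeff_succ_X_mul, coeff_coeffwise, map_add, map_sub,
      PowerSeries.coeff_C_mul, PowerSeries.coeff_X_pow, PowerSeries.coeff_mk]
    rcases m with _ | m <;> simp
  · simp only [uTrunc, shiftNeg, PowerSeries.coeff_succ_X_mul, coeff_coeffwise, map_add, map_sub,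
      PowerSeries.coeff_C_mul, PowerSeries.coeff_X_pow, PowerSeries.coeff_mk]
    rcases Nat.lt_trichotomy (n + 1) m with h | h | h
    · rw [if_pos (by omega), if_pos (by omega), if_pos (by omega),
        if_pos (by omega), if_neg (show ¬n + 1 + 1 = m + 1 by omega), map_neg,
        D1_bc_two]
      ring
    · subst h
      rw [if_pos (by omega), if_pos (by omega), if_neg (by omega), if_pos (by omega), if_pos rfl,
        map_neg,
        D1_bc_two]
      ring
    · rw [if_neg (by omega), if_neg (by omega), if_neg (by omega),
        if_neg (by omega), if_neg (show ¬n + 1 + 1 = m + 1 by omega), map_zero]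
      ring

/-- The flow of `D g m` on `U` in Lax form, with the truncation of `U` as the multiplier. -/
theorem X_pow_mul_flow_eq (m : ℕ) :
    PowerSeries.X ^ m * (PowerSeries.X * PowerSeries.mk (flowCoeff g m))
      = uTrunc g m 1 0 * uSeries g 0 1 - uTrunc g m 0 1 * uSeries g 1 0 := by
  have hsucc : ∀ (c : BPoly g) (i : Fin 3) (k : ℕ), uTrunc g (k + 1) c i
      = uTrunc g k c i + PowerSeries.C (shiftNeg g c i (k + 1)) * PowerSeries.X ^ (k + 1) := by
    intro c i k
    ext1 n
    simp only [uTrunc, map_add, PowerSeries.coeff_mk, PowerSeries.coeff_C_mul,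
      PowerSeries.coeff_X_pow]
    rcases Nat.lt_trichotomy n (k + 1) with h | h | h
    · rw [if_pos (by omega), if_pos (by omega), if_neg (by omega)]; ring
    · rw [if_pos (by omega), if_neg (by omega), if_pos h, h]; ring
    · rw [if_neg (by omega), if_neg (by omega), if_neg (by omega)]; ring
  induction m with
  | zero =>
    have h1 : uTrunc g 0 1 0 = 1 := by
      ext1 n
      rcases n with _ | n <;> simp [uTrunc, shiftNeg, PowerSeries.coeff_one]
    have h2 : uTrunc g 0 0 1 = 0 := by
      ext1 n
      rcases n with _ | n <;> simp [uTrunc, shiftNeg]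
    rw [h1, h2]
    ext1 n
    rcases n with _ | n
    · simp [uSeries, shiftNeg, PowerSeries.coeff_zero_X_mul]
    · simp [uSeries, shiftNeg, PowerSeries.coeff_succ_X_mul, flowCoeff_zero]
  | succ m ih =>
    have hf : PowerSeries.X * PowerSeries.mk (flowCoeff g (m + 1)) = PowerSeries.mk (flowCoeff g m)
        + (PowerSeries.C (shiftNeg g 1 0 (m + 1)) * uSeries g 0 1
          - PowerSeries.C (shiftNeg g 0 1 (m + 1)) * uSeries g 1 0) := by
      ext1 n
      rcases n with _ | n
      · simp only [map_add, map_sub, PowerSeries.coeff_C_mul, PowerSeries.coeff_zero_X_mul,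
          PowerSeries.coeff_mk, uSeries]
        -- The constant coefficient is the one place where the recursion in `m` does not suffice and
        -- the symmetry of the quotient is needed.
        rw [flowCoeff_symm, flowCoeff_zero]
        simp [shiftNeg]
      · simp only [map_add, map_sub, PowerSeries.coeff_C_mul, PowerSeries.coeff_succ_X_mul,
          PowerSeries.coeff_mk, uSeries, flowCoeff_succ, wronsk]
    rw [hsucc, hsucc]
    linear_combination PowerSeries.X ^ (m + 1) * hf + ih

variable {g}

theorem coeffwise_D_uSeries (m : Fin g) :
    coeffwise (D g m) (uSeries g 1 0) = PowerSeries.X * PowerSeries.mk (flowCoeff g m) := by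
  ext1 n
  rcases n with _ | n
  · simp [coeff_coeffwise, uSeries, shiftNeg, PowerSeries.coeff_zero_X_mul,
      -PowerSeries.coeff_zero_eq_constantCoeff]
  · simp [coeff_coeffwise, uSeries, shiftNeg, PowerSeries.coeff_succ_X_mul, D_bc_zero]

theorem coeffwise_D_uSeries_one (m : Fin g) : coeffwise (D g m) (uSeries g 0 1)
    = coeffwise (D1 g) (coeffwise (D g m) (uSeries g 1 0)) := by
  ext1 n
  rcases n with _ | n <;> simp [coeff_coeffwise, uSeries, shiftNeg, D_bc_one,
      -PowerSeries.coeff_zero_eq_constantCoeff]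

theorem coeffwise_D_uSeries_two (m : Fin g) : coeffwise (D g m) (uSeries g 0 2)
    = coeffwise (D1 g) (coeffwise (D1 g) (coeffwise (D g m) (uSeries g 1 0))) := by
  ext1 n
  rcases n with _ | n <;> simp [coeff_coeffwise, uSeries, shiftNeg, D_bc_two,
      -PowerSeries.coeff_zero_eq_constantCoeff]

/-! ### Invariance of the `λ`. -/

theorem D_lPoly (m : Fin g) (s : ℕ) : D g m (lPoly g s) = 0 := by
  have hX : (PowerSeries.X : PowerSeries (BPoly g)) ≠ 0 := PowerSeries.X_ne_zero
  have hT := X_pow_mul_flow_eq g m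
  rw [← coeffwise_D_uSeries] at hT
  have h1 := coeffwise_D_uSeries_one m
  have h2 := coeffwise_D_uSeries_two m
  have hΦ := congrArg (coeffwise (D g m)) (firstIntegral g)
  have hU3 := X_mul_coeffwise_D1_uSeries_two g
  have ha3 := X_mul_coeffwise_D1_uTrunc_two g m
  have hT1 := congrArg (coeffwise (D1 g)) hT
  simp only [coeffwise_sub, coeffwise_mul, coeffwise_X_pow, coeffwise_D1_uSeries,
    coeffwise_D1_uSeries_one, coeffwise_D1_uTrunc, coeffwise_D1_uTrunc_one, zero_mul,
    zero_add, ← h1] at hT1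
  have hT2 := congrArg (coeffwise (D1 g)) hT1
  simp only [coeffwise_sub, coeffwise_add, coeffwise_mul, coeffwise_X_pow, coeffwise_D1_uSeries,
    coeffwise_D1_uSeries_one, coeffwise_D1_uTrunc, coeffwise_D1_uTrunc_one, zero_mul,
    zero_add] at hT2
  rw [h1, ← h2] at hT2
  -- By symmetry of `flowCoeff`, the derivative of `b_{1,1}` along `D g m` is `b_{2,2m+1}`, the
  -- coefficient of the truncation defect in `ha3`.
  simp only [coeffwise_sub, coeffwise_add, coeffwise_mul, coeffwise_X_pow, coeffwise_C,
    coeffwise_X, coeffwise_one, D_bc_zero, flowCoeff_symm g m 0,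
    flowCoeff_zero, neg_neg] at hΦ
  simp only [map_mul, map_ofNat] at hU3 ha3
  have hc2 : coeffwise (D g m) 2 = 0 := by exact_mod_cast coeffwise_natCast (D g m) 2
  have hc4 : coeffwise (D g m) 4 = 0 := by exact_mod_cast coeffwise_natCast (D g m) 4
  rw [hc2, hc4] at hΦ
  generalize coeffwise (D g m) (uSeries g 1 0) = V0 at *
  generalize coeffwise (D g m) (uSeries g 0 1) = V1 at *
  generalize coeffwise (D g m) (uSeries g 0 2) = V2 at *
  generalize coeffwise (D1 g) (uSeries g 0 2) = U3 at *
  generalize coeffwise (D1 g) (uTrunc g m 0 2) = a3 at *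
  generalize uSeries g 0 2 = U2 at *
  generalize uSeries g 0 1 = U1 at *
  generalize uSeries g 1 0 = U at *
  generalize uTrunc g m 0 2 = a2 at *
  generalize uTrunc g m 0 1 = a1 at *
  generalize uTrunc g m 1 0 = a at *
  -- The factor `X^2` comes from `firstIntegral`, and `X^m` from the Lax form. Once `V0`, `V1`, `V2`
  -- are eliminated, all terms in `U''` and `a''` cancel, and the two third-order equations remove
  -- `U'''` and `a'''`.
  have hz : PowerSeries.X ^ (m.val + 2) *
      coeffwise (D g m) (PowerSeries.mk fun s => 4 * lPoly g s) = 0 := by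
    rw [pow_add]
    generalize PowerSeries.C (bc g 0 0) = c0 at *
    linear_combination (-PowerSeries.X ^ m.val) * hΦ
      + (8 * (2 * c0 * PowerSeries.X + 1) * U - 2 * PowerSeries.X * U2) * hT
      + 2 * PowerSeries.X * U1 * hT1 - 2 * PowerSeries.X * U * hT2
      - 2 * U * a * hU3 + 2 * U * U * ha3
  have hz' := (mul_eq_zero.mp hz).resolve_left (pow_ne_zero _ hX)
  have := congrArg (PowerSeries.coeff s) hz'
  have h4 : D g m (4 : BPoly g) = 0 := by exact_mod_cast (D g m).map_natCast 4
  simpa [coeff_coeffwise, h4] using this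

theorem D_rhoPullback (m : Fin g) (f : LPoly g) : D g m (rhoPullback g f) = 0 := by
  induction f using MvPolynomial.induction_on with
  | C a => simp [rhoPullback, algebraMap_eq]
  | add p q hp hq => simp [hp, hq]
  | mul_X p i hp =>
    rw [map_mul, Derivation.leibniz, hp]
    simp [rhoPullback, rho, D_lPoly]

/-! ### Dominance of `ρ` and injectivity of the pullback. -/

/-- A complex power series with nonzero constant term is, up to any given order, a square. -/
theorem exists_coeff_sq_eq (f : PowerSeries ℂ) (hf : PowerSeries.coeff 0 f ≠ 0) (n : ℕ) :
    ∃ h : PowerSeries ℂ, ∀ k < n + 1, PowerSeries.coeff k (h * h) = PowerSeries.coeff k f := by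
  induction n with
  | zero =>
    obtain ⟨z, hz⟩ := IsAlgClosed.exists_pow_nat_eq (PowerSeries.coeff 0 f) (n := 2) (by norm_num)
    refine ⟨PowerSeries.C z, fun k hk => ?_⟩
    obtain rfl : k = 0 := by omega
    rw [← hz, ← map_mul, PowerSeries.coeff_zero_C, sq]
  | succ n ih =>
    obtain ⟨h, hh⟩ := ih
    have h0 : PowerSeries.coeff 0 h ≠ 0 := by
      intro h0
      have := hh 0 (by omega)
      rw [PowerSeries.coeff_mul, Finset.Nat.antidiagonal_zero, Finset.sum_singleton, h0,
        mul_zero] at this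
      exact hf this.symm
    -- Newton step: a correction `t X^(n+1)` changes the coefficient of `X^(n+1)` in the square by
    -- `2 t` times the constant term of `h`, and no lower one.
    set t := (PowerSeries.coeff (n + 1) f - PowerSeries.coeff (n + 1) (h * h))
      / (2 * PowerSeries.coeff 0 h) with ht
    refine ⟨h + PowerSeries.C t * PowerSeries.X ^ (n + 1), fun k hk => ?_⟩
    have e : (h + PowerSeries.C t * PowerSeries.X ^ (n + 1))
        * (h + PowerSeries.C t * PowerSeries.X ^ (n + 1))
        = h * h + PowerSeries.X ^ (n + 1) * (PowerSeries.C (2 * t) * h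
          + PowerSeries.X * (PowerSeries.C (t ^ 2) * PowerSeries.X ^ n)) := by
      simp only [map_mul, map_ofNat, map_pow]
      ring
    rw [e, map_add, PowerSeries.coeff_X_pow_mul']
    split_ifs with hk'
    · obtain rfl : k = n + 1 := by omega
      rw [Nat.sub_self, map_add, PowerSeries.coeff_C_mul, PowerSeries.coeff_zero_X_mul, ht]
      field_simp
      ring
    · rw [hh k (by omega), add_zero]

variable (g)

theorem eval_lPoly_of_bExt_zero (b : BIdx g → ℂ) (h0 : ∀ n, bExt b 0 n = 0) (s : ℕ) :
    4 * eval b (lPoly g s)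
      = ∑ i ∈ Finset.range s, bExt b 1 i * bExt b 1 (s - 1 - i) + 2 * bExt b 2 s := by
  have := congrArg (eval b) (four_mul_lPoly g s)
  simp only [map_mul, map_ofNat, map_sub, map_add, map_sum, eval_aux, eval_bc, h0] at this
  rw [this]
  simp

/-- Every point of `ℂ^{2g}` whose last coordinate is nonzero is in the image of `ρ`. -/
theorem exists_eval_rho_eq (hg : 0 < g) (l : Fin (2 * g) → ℂ)
    (hl : l ⟨2 * g - 1, by omega⟩ ≠ 0) : ∃ b : BIdx g → ℂ, ∀ s, eval b (rho g s) = l s := by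
  -- With all `b_{1,j} = 0` and `s ≥ g` the `b_3` term vanishes, leaving a self-convolution of the
  -- `b_{2,j}`. Reversing indices makes this the squaring of a series whose constant term is
  -- governed by `λ_{4g+2}`; for `s < g` the free `b_{3,2s+1}` solves the equation.
  obtain ⟨h, hh⟩ := exists_coeff_sq_eq (PowerSeries.mk fun k => 4 * lExt l (2 * g - 1 - k))
    (by simpa [lExt, hg] using hl) g
  let c : ℕ → ℂ := fun i => if i < g then PowerSeries.coeff (g - 1 - i) h else 0
  let b : BIdx g → ℂ := fun q => ![0, c q.2,
    2 * lExt l q.2 - (1 / 2) * ∑ i ∈ Finset.range q.2, c i * c (q.2 - 1 - i)] q.1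
  have b0 : ∀ n, bExt b 0 n = 0 := by
    intro n; unfold bExt; split_ifs <;> simp [b]
  have b1 : ∀ n, bExt b 1 n = c n := by
    intro n; unfold bExt; split_ifs with hn <;> simp [b, c, hn]
  refine ⟨b, fun s => ?_⟩
  have hs := s.2
  have key := eval_lPoly_of_bExt_zero g b b0 s
  simp only [b1] at key
  have hls : l s = lExt l s := by simp [lExt, hs]
  rw [rho, hls]
  suffices 4 * eval b (lPoly g s) = 4 * lExt l s by linear_combination (1 / 4 : ℂ) * this
  rw [key]
  rcases Nat.lt_or_ge s.val g with h' | h'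
  · rw [bExt, dif_pos h']
    simp only [b, Matrix.cons_val]
    ring
  · rw [bExt, dif_neg (by omega), mul_zero, add_zero]
    have hk := hh (2 * g - 1 - s) (by omega)
    rw [PowerSeries.coeff_mk, show 2 * g - 1 - (2 * g - 1 - s.val) = s.val by omega] at hk
    rw [← hk, PowerSeries.coeff_mul, Finset.Nat.sum_antidiagonal_eq_sum_range_succ_mk]
    generalize hA : s.val - g = A
    generalize hN : 2 * g - 1 - s.val = N
    -- Only `s - g ≤ i < g` contributes; in each outer block of length `s - g` one of the two
    -- factors has index at least `g`.
    rw [show s.val = A + (N + 1) + A by omega, Finset.sum_range_add, Finset.sum_range_add,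
      Finset.sum_eq_zero (s := Finset.range A), Finset.sum_eq_zero (s := Finset.range A), zero_add,
      add_zero]
    · refine Finset.sum_congr rfl fun i hi => ?_
      have := Finset.mem_range.mp hi
      simp only [c]
      rw [if_pos (by omega), if_pos (by omega), mul_comm]
      congr 3 <;> omega
    · intro i hi
      simp only [c]
      rw [if_neg (by omega), zero_mul]
    · intro i hi
      have := Finset.mem_range.mp hi
      simp only [c]
      rw [if_neg (show ¬A + (N + 1) + A - 1 - i < g by omega), mul_zero]

theorem rhoPullback_injective (hg : 0 < g) : Function.Injective (rhoPullback g) := by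
  rw [injective_iff_map_eq_zero]
  intro f hf
  have hX : (X ⟨2 * g - 1, by omega⟩ : LPoly g) ≠ 0 := X_ne_zero _
  -- Multiplying by `λ_{4g+2}` makes the product vanish at every point: off the hyperplane by
  -- surjectivity, on it trivially.
  refine (mul_eq_zero.mp (?_ : f * X ⟨2 * g - 1, by omega⟩ = 0)).resolve_right hX
  refine MvPolynomial.funext fun l => ?_
  rw [map_mul, eval_X, map_zero]
  by_cases hl : l ⟨2 * g - 1, by omega⟩ = 0
  · rw [hl, mul_zero]
  · obtain ⟨b, hb⟩ := exists_eval_rho_eq g hg l hl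
    have := congrArg (eval b) hf
    have hc : (eval b).comp (rhoPullback g : LPoly g →+* BPoly g) = eval l :=
      MvPolynomial.ringHom_ext (fun r => by simp [rhoPullback, algebraMap_eq])
        fun i => by simp [rhoPullback, hb]
    rw [← hc, RingHom.comp_apply, RingHom.coe_coe, hf, map_zero, zero_mul]

end Hyperelliptic

theorem corollary4p3 (g : ℕ) (m : Fin g) :
    Hyperelliptic.IsProjectable g (Hyperelliptic.D g m) ∧
      ∀ L : Derivation ℂ (Hyperelliptic.LPoly g) (Hyperelliptic.LPoly g),
        Hyperelliptic.IsPushforward g (Hyperelliptic.D g m) L ↔ L = 0 := by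
  have h0 : Hyperelliptic.IsPushforward g (Hyperelliptic.D g m) 0 := fun f => by
    simp [Hyperelliptic.D_rhoPullback]
  refine ⟨⟨0, h0⟩, fun L => ⟨fun h => ?_, fun h => h ▸ h0⟩⟩
  ext1 i
  -- A derivation is determined on coordinates, and `ρ^*` of `L λ` is the derivative of `ρ^* λ`
  -- along the field, which is zero.
  apply Hyperelliptic.rhoPullback_injective g m.pos
  rw [← h, Hyperelliptic.D_rhoPullback, Derivation.zero_apply, map_zero]
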